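/- Conventions. Let $\pi$ be a set of primes and let $\pi'$ be the set of primes not in $\pi$. A finite group is a $\pi$-group if every prime dividing its order lies in $\pi$ (so for $\pi=\emptyset$ only the trivial group is one), and similarly for $\pi'$. A subgroup of a semigroup $S$ is a subsemigroup of $S$ that is a group (its identity need not be an identity of $S$). Let $\overline{\mathbf G}_\pi$ be the pseudovariety of finite semigroups all of whose subgroups are $\pi$-groups. A relational morphism $\varphi\colon T\to S$ of semigroups assigns to each $t\in T$ a nonempty subset $t\varphi\subseteq S$ such that $(t\varphi)(t'\varphi)\subseteq (tt')\varphi$ for all $t,t'\in T$; for $s\in S$ put $s\varphi^{-1}=\{t\in T\mid s\in t\varphi\}$. A subset $Z\subseteq T$ is $\overline{\mathbf G}_\pi$-pointlike if for every relational morphism $\varphi\colon T\to S$ with $S\in\overline{\mathbf G}_\pi$ there is $s\in S$ with $Z\subseteq s\varphi^{-1}$. For a finite semigroup $T$, the power semigroup $P(T)$ is the set of all subsets of $T$ with product $XY=\{xy\mid x\in X,\ y\in Y\}$; for $Z\in P(T)$ let $Z^{\omega}$ be the unique idempotent among the powers $Z^n$, $n\ge 1$, and put $Z^{\omega+\ast}=Z^{\omega}\cdot\bigcup_{n\geq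 1}Z^n$. Theorem. Let $\pi$ be a set of primes and $T$ a finite semigroup. Let $CP_\pi(T)$ be the smallest subsemigroup of $P(T)$ that contains all singletons $\{t\}$, $t\in T$, and is closed under $Z\mapsto Z^{\omega+\ast}$ for all its members $Z$ that generate a cyclic $\pi'$-group (that is, such that $\{Z^n\mid n\ge 1\}$ is a group whose order is divisible by no prime in $\pi$). Then a subset $X\subseteq T$ is $\overline{\mathbf G}_\pi$-pointlike if and only if $X\subseteq Y$ for some $Y\in CP_\pi(T)$. -/

import Mathlib

open scoped Pointwise

universe u v

namespace PiPointlike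

section Semigroups

variable {S : Type*} [Semigroup S]

/-- Positive powers in a semigroup: `posPow s n` is `s ^ (n + 1)`. -/
def posPow (s : S) : ℕ → S
  | 0 => s
  | n + 1 => posPow s n * s

theorem posPow_mul_posPow (s : S) (m n : ℕ) :
    posPow s m * posPow s n = posPow s (m + n + 1) := by
  induction n with
  | zero => rfl
  | succ k ih =>
    change posPow s m * (posPow s k * s) = posPow s (m + k + 1) * s
    rw [← mul_assoc, ih]

/-- In a finite semigroup, some positive power of each element is idempotent. -/
theorem exists_idempotent_posPow [Finite S] (s : S) :
    ∃ e : S, IsIdempotentElem e ∧ ∃ n : ℕ, e = posPow s n := by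
  obtain ⟨a, b, hab, h⟩ := Finite.exists_ne_map_eq_of_infinite (posPow s)
  wlog hlt : a < b generalizing a b
  · exact this b a hab.symm h.symm (by omega)
  obtain ⟨d, rfl⟩ : ∃ d, b = a + d + 1 := ⟨b - a - 1, by omega⟩
  have step : ∀ i, posPow s (a + i) = posPow s (a + i + (d + 1)) := by
    intro i
    rcases i with _ | i
    · simpa [add_assoc] using h
    · have := congrArg (· * posPow s i) h
      simp only [posPow_mul_posPow] at this
      rw [show a + (i + 1) = a + i + 1 by omega, this]
      congr 1
      omega
  have step' : ∀ k i, posPow s (a + i) = posPow s (a + i + k * (d + 1)) := by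
    intro k
    induction k with
    | zero => simp
    | succ k ih =>
      intro i
      rw [ih i, add_assoc a i, step (i + k * (d + 1))]
      congr 1
      ring
  refine ⟨posPow s (a + (a * d + d)), ?_, _, rfl⟩
  unfold IsIdempotentElem
  rw [posPow_mul_posPow, step' (a + 1) (a * d + d)]
  congr 1
  ring

/-- The idempotent positive power of `s` is unique. -/
theorem idempotent_posPow_unique (s e f : S) (he : IsIdempotentElem e) (hf : IsIdempotentElem f)
    (hes : ∃ n : ℕ, e = posPow s n) (hfs : ∃ n : ℕ, f = posPow s n) : e = f := by
  have key : ∀ g : S, IsIdempotentElem g → ∀ k, posPow g k = g := by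
    intro g hg k
    induction k with
    | zero => rfl
    | succ k ih => change posPow g k * g = g; rw [ih]; exact hg
  have pp : ∀ m k, posPow (posPow s m) k = posPow s (m * k + m + k) := by
    intro m k
    induction k with
    | zero => simp [posPow]
    | succ k ih =>
      change posPow (posPow s m) k * posPow s m = _
      rw [ih, posPow_mul_posPow]
      congr 1
      ring
  obtain ⟨m, rfl⟩ := hes
  obtain ⟨n, rfl⟩ := hfs
  rw [← key _ he n, pp, ← key _ hf m, pp]
  congr 1
  ring

/-- `s ^ ω`, the unique idempotent positive power of an element of a finite semigroup. -/
noncomputable def omegaPow [Finite S] (s : S) : S :=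
  Classical.choose (exists_idempotent_posPow s)

theorem omegaPow_spec [Finite S] (s : S) :
    IsIdempotentElem (omegaPow s) ∧ ∃ n : ℕ, omegaPow s = posPow s n :=
  Classical.choose_spec (exists_idempotent_posPow s)

/-- The subsemigroup `G` of `S` is a group (its identity `e` need not be an identity of `S`). -/
def IsSubgroup (G : Subsemigroup S) : Prop :=
  ∃ e ∈ G, ∀ g ∈ G, e * g = g ∧ g * e = g ∧ ∃ h ∈ G, g * h = e ∧ h * g = e

/-- The subsemigroup `G` (of a finite semigroup) is a `π`-group: it is a group, and all primes
dividing its order belong to `π`. -/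
def IsPiSubgroup (π : Set Nat.Primes) (G : Subsemigroup S) : Prop :=
  IsSubgroup G ∧ ∀ p : Nat.Primes, (p : ℕ) ∣ Nat.card G → p ∈ π

end Semigroups

/-- The class (pseudovariety) of finite semigroups all of whose subgroups are `π`-groups. -/
def GBar (π : Set Nat.Primes) (S : Type v) [Semigroup S] : Prop :=
  Finite S ∧ ∀ G : Subsemigroup S, IsSubgroup G → IsPiSubgroup π G

/-- A relational morphism `T → S`: `t φ = {s | rel t s}` is nonempty for every `t`, and
`(t φ) (t' φ) ⊆ (t t') φ`. -/
structure RelMorphism (T : Type u) (S : Type v) [Semigroup T] [Semigroup S] where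
  rel : T → S → Prop
  total : ∀ t, ∃ s, rel t s
  mul : ∀ {t t' s s'}, rel t s → rel t' s' → rel (t * t') (s * s')

/-- The inverse image `s φ⁻¹ = {t | s ∈ t φ}`. -/
def RelMorphism.inv {T : Type u} {S : Type v} [Semigroup T] [Semigroup S]
    (φ : RelMorphism T S) (s : S) : Set T :=
  {t | φ.rel t s}

/-- The collection of `V`-pointlike subsets of `T`, for a class `V` of semigroups. -/
def pointlikes (V : ∀ (S : Type v) [Semigroup S], Prop) (T : Type u) [Semigroup T] :
    Set (Set T) :=
  {Z | ∀ (S : Type v) [Semigroup S], V S → ∀ φ : RelMorphism T S, ∃ s : S, Z ⊆ φ.inv s}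

section PowerSemigroup

/- The power semigroup of `T` is `Set T` with the pointwise product. -/
attribute [local instance] Set.semigroup

variable {T : Type u} [Semigroup T] [Finite T]

/-- `Z ^ (ω + *) = Z ^ ω * ⋃ n ≥ 1, Z ^ n`, in the power semigroup of `T`. -/
noncomputable def omegaPlusStar (Z : Set T) : Set T :=
  omegaPow Z * ⋃ n : ℕ, posPow Z n

/-- `Z` generates a (necessarily cyclic) `π`-group in the power semigroup of `T`. -/
def GeneratesPiGroup (π : Set Nat.Primes) (Z : Set T) : Prop :=
  IsPiSubgroup π (Subsemigroup.closure {Z})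

/-- The smallest subsemigroup of the power semigroup of `T` that contains the singletons and is
closed under `Z ↦ Z ^ (ω + *)` whenever `Z` generates a cyclic `π'`-group, where `π' = πᶜ`. -/
noncomputable def CP (π : Set Nat.Primes) (T : Type u) [Semigroup T] [Finite T] :
    Subsemigroup (Set T) :=
  sInf {U | (∀ t : T, {t} ∈ U) ∧ ∀ Z ∈ U, GeneratesPiGroup πᶜ Z → omegaPlusStar Z ∈ U}

end PowerSemigroup

end PiPointlike

/-!
Suppose `Z ⊆ s φ⁻¹` generates a `π'`-group of order `m`. Some power `s ^ e` with `e ≡ 1` modulo `m`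
generates a `π'`-group too, so it is idempotent if all subgroups of its semigroup are `π`-groups.
As `Z = Z ^ e ⊆ (s ^ e) φ⁻¹`, this preimage contains all powers of `Z`, hence `Z ^ (ω + *)`.
Therefore the members of `CP π T` are pointlike.

Conversely, it suffices to map the words over `T` to a finite monoid with only `π`-subgroups, such
that the values of all words in a fibre lie in a single member of `CP π T`. Of `CP π T` one needs
only that it is an ordered monoid (after adding an identity) in which the powers of an element `z`
generating a `π'`-group have a join, and that products distribute over these joins. In such a
monoid `M`, the values of the letters being `α : A → M`, one inducts on `(|M|, |A|)`. If all
letters are units, one maps to `Mˣ / O^π(Mˣ)`: the group `O^π(Mˣ)` is generated by elements of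
`π'`-order, and the product of suitable joins bounds it from above. Otherwise words are cut at a
letter whose value `c` is not a unit. The blocks have values in `M` over a smaller alphabet, and
they become the letters of words over the local divisor `M c ∩ c M`, which is smaller than `M` and
inherits the joins. The two monoids obtained by induction combine in a Rees extension, and this
does not create new groups.
-/

universe w

namespace PiPointlike

section PiNumbers

variable {π : Set Nat.Primes} {a b : ℕ}

/-- A `π`-number: all its prime divisors belong to `π`. A `π'`-number is a `πᶜ`-number. -/
def IsPiNumber (π : Set Nat.Primes) (n : ℕ) : Prop :=
  ∀ p : Nat.Primes, (p : ℕ) ∣ n → p ∈ π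

theorem isPiNumber_one (π : Set Nat.Primes) : IsPiNumber π 1 :=
  fun p hp => absurd (Nat.dvd_one.1 hp) p.2.ne_one

theorem isPiNumber_prime_iff {p : Nat.Primes} : IsPiNumber π p ↔ p ∈ π := by
  refine ⟨fun h => h p dvd_rfl, fun hp q hq => ?_⟩
  rwa [Nat.Primes.coe_nat_injective ((Nat.prime_dvd_prime_iff_eq q.2 p.2).1 hq)]

theorem IsPiNumber.mul (ha : IsPiNumber π a) (hb : IsPiNumber π b) : IsPiNumber π (a * b) :=
  fun p hp => (p.2.dvd_mul.1 hp).elim (ha p) (hb p)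

theorem IsPiNumber.of_dvd (hb : IsPiNumber π b) (h : a ∣ b) : IsPiNumber π a :=
  fun p hp => hb p (hp.trans h)

theorem IsPiNumber.coprime (ha : IsPiNumber π a) (hb : IsPiNumber πᶜ b) : a.Coprime b :=
  Nat.coprime_of_dvd fun p hp h₁ h₂ => hb ⟨p, hp⟩ h₂ (ha ⟨p, hp⟩ h₁)

theorem exists_eq_isPiNumber_mul (π : Set Nat.Primes) {n : ℕ} (hn : n ≠ 0) :
    ∃ a b, n = a * b ∧ IsPiNumber π a ∧ IsPiNumber πᶜ b := by
  induction n using Nat.recOnMul with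
  | zero => exact absurd rfl hn
  | one => exact ⟨1, 1, rfl, isPiNumber_one _, isPiNumber_one _⟩
  | prime p hp =>
    have hpπ {ρ : Set Nat.Primes} := isPiNumber_prime_iff (π := ρ) (p := ⟨p, hp⟩)
    by_cases h : ⟨p, hp⟩ ∈ π
    · exact ⟨p, 1, (mul_one p).symm, hpπ.2 h, isPiNumber_one _⟩
    · exact ⟨1, p, (one_mul p).symm, isPiNumber_one _, hpπ.2 h⟩
  | mul x y hx hy =>
    obtain ⟨a, b, rfl, ha, hb⟩ := hx (left_ne_zero_of_mul hn)
    obtain ⟨a', b', rfl, ha', hb'⟩ := hy (right_ne_zero_of_mul hn)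
    exact ⟨a * a', b * b', mul_mul_mul_comm _ _ _ _, ha.mul ha', hb.mul hb'⟩

theorem exists_le_mul_and_dvd_mul_add_one (ha : a ≠ 0) (hb : b ≠ 0) (hab : a.Coprime b) (n : ℕ) :
    ∃ j, n ≤ j * b ∧ a ∣ j * b + 1 := by
  have hco : (a * (n * b + 1)).Coprime b := hab.mul_left (by simp)
  have hφ : b.totient ≠ 0 := (Nat.totient_pos.2 (Nat.pos_of_ne_zero hb)).ne'
  have hle : n * b + 1 ≤ (a * (n * b + 1)) ^ b.totient :=
    (Nat.le_mul_of_pos_left _ (Nat.pos_of_ne_zero ha)).trans (Nat.le_self_pow hφ _)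
  obtain ⟨j, hj⟩ := (Nat.modEq_iff_dvd' (by omega)).1 (Nat.ModEq.pow_totient hco).symm
  have hjb : j * b + 1 = (a * (n * b + 1)) ^ b.totient := by rw [mul_comm j, ← hj]; omega
  refine ⟨j, ?_, hjb ▸ dvd_pow (dvd_mul_right _ _) hφ⟩
  have := Nat.le_mul_of_pos_right n (Nat.pos_of_ne_zero hb)
  omega

end PiNumbers

section Powers

variable {S R : Type*} [Semigroup S] [Semigroup R] {s x : S} {m n : ℕ}

theorem posPow_eq_pow {M : Type*} [Monoid M] (x : M) (n : ℕ) : posPow x n = x ^ (n + 1) := by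
  induction n with
  | zero => exact (pow_one x).symm
  | succ n ih => rw [posPow, ih, pow_succ _ (n + 1)]

theorem map_posPow {F : Type*} [FunLike F S R] [MulHomClass F S R] (f : F) (s : S) (n : ℕ) :
    f (posPow s n) = posPow (f s) n := by
  induction n with
  | zero => rfl
  | succ n ih => rw [posPow, map_mul, ih, posPow]

theorem posPow_posPow (s : S) (m n : ℕ) : posPow (posPow s m) n = posPow s (m + (m + 1) * n) := by
  induction n with
  | zero => rfl
  | succ n ih => rw [posPow, ih, posPow_mul_posPow]; congr 1; ring

theorem periodic_posPow (h : posPow s m = s) : Function.Periodic (posPow s) m := by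
  intro n
  cases n with
  | zero => rwa [zero_add]
  | succ n =>
    have := congrArg (posPow s n * ·) h
    rwa [posPow_mul_posPow, ← Nat.add_right_comm n 1 m] at this

theorem posPow_add_mul_of_isIdempotentElem {i : ℕ} (h : IsIdempotentElem (posPow s n))
    (hi : n ≤ i) (q : ℕ) : posPow s (i + q * (n + 1)) = posPow s i := by
  have hper : posPow s (n + (n + 1)) = posPow s n := (posPow_mul_posPow s n n).symm.trans h
  have hstep (k : ℕ) : posPow s (n + k + (n + 1)) = posPow s (n + k) := by
    cases k with
    | zero => exact hper
    | succ k =>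
      have := congrArg (· * posPow s k) hper
      simp only [posPow_mul_posPow] at this
      rw [← add_assoc n k 1, ← this]
      congr 1
      ring
  obtain ⟨k, rfl⟩ := Nat.exists_eq_add_of_le hi
  induction q with
  | zero => rw [zero_mul, add_zero]
  | succ q ih => rw [add_one_mul, ← add_assoc, add_assoc n k, hstep, ← add_assoc, ih]

theorem posPow_of_isIdempotentElem (h : IsIdempotentElem s) (n : ℕ) : posPow s n = s := by
  simpa [posPow] using posPow_add_mul_of_isIdempotentElem (n := 0) (i := 0) h le_rfl n

theorem mem_closure_singleton_iff : x ∈ Subsemigroup.closure {s} ↔ ∃ n, posPow s n = x := by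
  refine ⟨fun h => ?_, ?_⟩
  · induction h using Subsemigroup.closure_induction with
    | mem x hx => exact ⟨0, hx.symm⟩
    | mul x y _ _ hx hy =>
      obtain ⟨m, rfl⟩ := hx
      obtain ⟨n, rfl⟩ := hy
      exact ⟨_, (posPow_mul_posPow s m n).symm⟩
  · rintro ⟨n, rfl⟩
    induction n with
    | zero => exact Subsemigroup.subset_closure rfl
    | succ n ih => exact mul_mem ih (Subsemigroup.subset_closure rfl)

end Powers

section PiPeriodic

variable {π : Set Nat.Primes} {S R : Type*} [Semigroup S] [Semigroup R] {s : S} {m : ℕ}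

/-- An element is `π`-periodic if it has a period which is a `π`-number. In a finite semigroup this
means that it generates a cyclic `π`-group, see `isPiSubgroup_closure_singleton_iff`. -/
def IsPiPeriodic (π : Set Nat.Primes) (s : S) : Prop :=
  ∃ m, m ≠ 0 ∧ IsPiNumber π m ∧ posPow s m = s

theorem IsPiPeriodic.map {F : Type*} [FunLike F S R] [MulHomClass F S R] (f : F)
    (hs : IsPiPeriodic π s) : IsPiPeriodic π (f s) := by
  obtain ⟨m, hm, hmπ, h⟩ := hs
  exact ⟨m, hm, hmπ, by rw [← map_posPow, h]⟩

/-- Write `n + 1 = a * r` for an idempotent power `s ^ (n + 1)`, with a `π`-number `a` and a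
`π'`-number `r`. Any large power of `s` with exponent divisible by `a` has period `r`, and the
exponent can be taken `≡ 1` modulo the `π'`-number `m`. -/
theorem exists_isPiPeriodic_posPow_mul [Finite S] (s : S) (hm : m ≠ 0) (hmπ : IsPiNumber πᶜ m) :
    ∃ j, IsPiPeriodic πᶜ (posPow s (j * m)) := by
  obtain ⟨_, he, n, rfl⟩ := exists_idempotent_posPow s
  obtain ⟨a, r, har, ha, hr⟩ := exists_eq_isPiNumber_mul π n.succ_ne_zero
  have har₀ : a * r ≠ 0 := har ▸ n.succ_ne_zero
  obtain ⟨j, hnj, q, hq⟩ := exists_le_mul_and_dvd_mul_add_one (left_ne_zero_of_mul har₀) hm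
    (ha.coprime hmπ) n
  refine ⟨j, r, right_ne_zero_of_mul har₀, hr, ?_⟩
  rw [posPow_posPow, hq, mul_assoc, mul_left_comm, ← har]
  exact posPow_add_mul_of_isIdempotentElem he hnj q

/-- The group structure on a subgroup of a semigroup. -/
noncomputable abbrev IsSubgroup.group {G : Subsemigroup S} (hG : IsSubgroup G) : Group G :=
  let e := Classical.choose hG
  have he := Classical.choose_spec hG
  letI : One G := ⟨⟨e, he.1⟩⟩
  letI : Inv G := ⟨fun g => ⟨Classical.choose (he.2 g g.2).2.2,
    (Classical.choose_spec (he.2 g g.2).2.2).1⟩⟩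
  Group.ofLeftAxioms mul_assoc (fun g => Subtype.ext (he.2 g g.2).1)
    (fun g => Subtype.ext (Classical.choose_spec (he.2 g g.2).2.2).2.2)

theorem isSubgroup_closure_singleton (hm : m ≠ 0) (h : posPow s m = s) :
    IsSubgroup (Subsemigroup.closure {s}) := by
  obtain ⟨k, rfl⟩ := Nat.exists_eq_succ_of_ne_zero hm
  have hper := periodic_posPow h
  have hone (n : ℕ) : posPow s (n + k + 1) = posPow s n := hper n
  have hinv (n : ℕ) : n + (k + (n + 1) * k) + 1 = k + n * (k + 1) + 1 * (k + 1) := by ring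
  refine ⟨posPow s k, mem_closure_singleton_iff.2 ⟨k, rfl⟩, fun g hg => ?_⟩
  obtain ⟨n, rfl⟩ := mem_closure_singleton_iff.1 hg
  refine ⟨?_, ?_, posPow s (k + (n + 1) * k), mem_closure_singleton_iff.2 ⟨_, rfl⟩, ?_, ?_⟩
  · rw [posPow_mul_posPow, add_comm k n, hone]
  · rw [posPow_mul_posPow, hone]
  · rw [posPow_mul_posPow, hinv]
    exact (hper.nat_mul _ _).trans (hper.nat_mul _ _)
  · rw [posPow_mul_posPow, add_comm _ n, hinv]
    exact (hper.nat_mul _ _).trans (hper.nat_mul _ _)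

theorem card_closure_singleton_dvd (hm : m ≠ 0) (h : posPow s m = s) :
    Nat.card (Subsemigroup.closure {s}) ∣ m := by
  let _ := (isSubgroup_closure_singleton hm h).group
  let ι := MulMemClass.subtype (Subsemigroup.closure {s})
  let g : Subsemigroup.closure {s} := ⟨s, Subsemigroup.subset_closure rfl⟩
  have hg (x : Subsemigroup.closure {s}) : x ∈ Subgroup.zpowers g := by
    obtain ⟨n, hn⟩ := mem_closure_singleton_iff.1 x.2
    have : g ^ (n + 1) = x := by
      rw [← posPow_eq_pow]
      exact Subtype.ext ((map_posPow ι g n).trans hn)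
    exact this ▸ Subgroup.npow_mem_zpowers g _
  have hgm : g ^ (m + 1) = g := by
    rw [← posPow_eq_pow]
    exact Subtype.ext ((map_posPow ι g m).trans h)
  rw [← orderOf_eq_card_of_forall_mem_zpowers hg]
  exact orderOf_dvd_of_pow_eq_one (by rwa [pow_succ, mul_eq_right] at hgm)

theorem posPow_card_closure_singleton (hs : IsSubgroup (Subsemigroup.closure {s})) :
    posPow s (Nat.card (Subsemigroup.closure {s})) = s := by
  let _ := hs.group
  let g : Subsemigroup.closure {s} := ⟨s, Subsemigroup.subset_closure rfl⟩
  have hg : posPow g (Nat.card (Subsemigroup.closure {s})) = g := by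
    rw [posPow_eq_pow, pow_succ, pow_card_eq_one', one_mul]
  have := congrArg (MulMemClass.subtype _) hg
  rwa [map_posPow] at this

theorem isPiSubgroup_closure_singleton_iff [Finite S] :
    IsPiSubgroup π (Subsemigroup.closure {s}) ↔ IsPiPeriodic π s := by
  constructor
  · rintro ⟨hG, hπ⟩
    have : Nonempty (Subsemigroup.closure {s}) := ⟨s, Subsemigroup.subset_closure rfl⟩
    exact ⟨_, Nat.card_pos.ne', hπ, posPow_card_closure_singleton hG⟩
  · rintro ⟨m, hm, hmπ, h⟩
    exact ⟨isSubgroup_closure_singleton hm h, hmπ.of_dvd (card_closure_singleton_dvd hm h)⟩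

theorem IsPiPeriodic.omegaPow_mul_self [Finite S] (hs : IsPiPeriodic π s) :
    omegaPow s * s = s := by
  obtain ⟨m, hm, -, h⟩ := hs
  obtain ⟨k, rfl⟩ := Nat.exists_eq_succ_of_ne_zero hm
  obtain ⟨he, n, hn⟩ := omegaPow_spec s
  calc omegaPow s * s = posPow (posPow s n) k * posPow s 0 := by
        rw [← hn, posPow_of_isIdempotentElem he, posPow]
    _ = posPow s ((n + 1) * (k + 1)) := by
        rw [posPow_posPow, posPow_mul_posPow]; congr 1; ring
    _ = s := (periodic_posPow h).nat_mul_eq _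

theorem IsPiPeriodic.omegaPow_mul_posPow [Finite S] (hs : IsPiPeriodic π s) (n : ℕ) :
    omegaPow s * posPow s n = posPow s n := by
  induction n with
  | zero => exact hs.omegaPow_mul_self
  | succ n ih => rw [posPow, ← mul_assoc, ih]

end PiPeriodic
theorem isPiPeriodic_iff_pow_eq_one {π : Set Nat.Primes} {G : Type*} [Group G] {g : G} :
    IsPiPeriodic π g ↔ ∃ m, m ≠ 0 ∧ IsPiNumber π m ∧ g ^ m = 1 := by
  simp only [IsPiPeriodic, posPow_eq_pow, pow_succ, mul_eq_right]

section PiAperiodic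

variable {π : Set Nat.Primes} {S R : Type*} [Semigroup S] [Semigroup R]

/-- A semigroup is `π`-aperiodic if it has no nontrivial cyclic `π'`-subgroups. For finite
semigroups this is membership in `GBar π`, see `gBar_iff`. -/
def PiAperiodic (π : Set Nat.Primes) (S : Type*) [Semigroup S] : Prop :=
  ∀ s : S, IsPiPeriodic πᶜ s → IsIdempotentElem s

theorem PiAperiodic.of_injective (hS : PiAperiodic π S) {F : Type*} [FunLike F R S]
    [MulHomClass F R S] (f : F) (hf : Function.Injective f) : PiAperiodic π R :=
  fun s hs => hf ((map_mul f s s).trans (hS (f s) (hs.map f)))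

theorem gBar_iff : GBar π S ↔ Finite S ∧ PiAperiodic π S := by
  refine and_congr_right fun _ => ⟨fun hS s hs => ?_, fun hS G hG => ⟨hG, fun p hp => ?_⟩⟩
  · obtain ⟨hG, hG'⟩ := isPiSubgroup_closure_singleton_iff.2 hs
    have hcard : Nat.card (Subsemigroup.closure {s}) = 1 :=
      (Nat.coprime_self _).1 (IsPiNumber.coprime (hS _ hG).2 hG')
    have := (Nat.card_eq_one_iff_unique.1 hcard).1
    have hmem : s ∈ Subsemigroup.closure {s} := Subsemigroup.subset_closure rfl
    exact congrArg Subtype.val (Subsingleton.elim (⟨s * s, mul_mem hmem hmem⟩ : _) ⟨s, hmem⟩)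
  · by_contra hpπ
    let _ := hG.group
    have := Fact.mk p.2
    obtain ⟨g, hg⟩ := exists_prime_orderOf_dvd_card' (G := G) (p : ℕ) hp
    have hgper : IsPiPeriodic πᶜ g := isPiPeriodic_iff_pow_eq_one.2
      ⟨p, p.2.ne_zero, isPiNumber_prime_iff.2 hpπ, hg ▸ pow_orderOf_eq_one g⟩
    have hgid := hS.of_injective (MulMemClass.subtype G) Subtype.val_injective g hgper
    rw [IsIdempotentElem, mul_eq_left] at hgid
    rw [hgid, orderOf_one] at hg
    exact p.2.ne_one hg.symm

end PiAperiodic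

/-- An ordered monoid is `π'`-complete if the powers of each `π'`-periodic element have a join, and
multiplication distributes over these joins. -/
def PiComplete (π : Set Nat.Primes) (M : Type*) [Monoid M] [PartialOrder M] : Prop :=
  ∀ z : M, IsPiPeriodic πᶜ z →
    ∃ Y, ∀ a b, IsLUB (Set.range fun n => a * posPow z n * b) (a * Y * b)

/-! ### Local divisors -/

/-- The local divisor `M c ∩ c M` of a monoid `M` at `c`, with the product `uc ∘ cv = ucv` and the
identity `c`. It divides `M`, and it is smaller than a finite `M` unless `c` is a unit. -/
@[ext]
structure LocalDivisor {M : Type*} [Monoid M] (c : M) where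
  val : M
  left : ∃ u, val = u * c
  right : ∃ v, val = c * v

namespace LocalDivisor

section Monoid

variable {M : Type*} [Monoid M] {c : M}

theorem val_injective : Function.Injective (val : LocalDivisor c → M) :=
  fun _ _ => LocalDivisor.ext

noncomputable instance : Mul (LocalDivisor c) where
  mul x y := ⟨x.left.choose * y.val, by
    obtain ⟨u, hu⟩ := y.left
    exact ⟨x.left.choose * u, by rw [hu, mul_assoc]⟩, by
    obtain ⟨v, hv⟩ := y.right
    obtain ⟨w, hw⟩ := x.right
    exact ⟨w * v, by rw [hv, ← mul_assoc, ← x.left.choose_spec, hw, mul_assoc]⟩⟩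

theorem val_mul_of_right (x : LocalDivisor c) {y : LocalDivisor c} {v : M} (h : y.val = c * v) :
    (x * y).val = x.val * v := by
  change x.left.choose * y.val = _
  rw [h, ← mul_assoc, ← x.left.choose_spec]

theorem val_mul_of_left {x : LocalDivisor c} (y : LocalDivisor c) {u : M} (h : x.val = u * c) :
    (x * y).val = u * y.val := by
  obtain ⟨v, hv⟩ := y.right
  rw [val_mul_of_right x hv, h, hv, mul_assoc]

theorem val_mul_mul (x : LocalDivisor c) {a b : LocalDivisor c} {u v : M} (ha : a.val = u * c)
    (hb : b.val = c * v) : (a * x * b).val = u * x.val * v := by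
  rw [val_mul_of_right _ hb, val_mul_of_left _ ha]

instance : One (LocalDivisor c) := ⟨⟨c, ⟨1, (one_mul c).symm⟩, ⟨1, (mul_one c).symm⟩⟩⟩

theorem val_one : (1 : LocalDivisor c).val = c := rfl

noncomputable instance : Monoid (LocalDivisor c) where
  mul_assoc x y z := LocalDivisor.ext <| by
    obtain ⟨u, hu⟩ := x.left
    obtain ⟨v, hv⟩ := z.right
    rw [val_mul_mul y hu hv, val_mul_of_left _ hu, val_mul_of_right _ hv, mul_assoc]
  one_mul x := LocalDivisor.ext <| by
    rw [val_mul_of_left x (val_one.trans (one_mul c).symm), one_mul]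
  mul_one x := LocalDivisor.ext <| by
    rw [val_mul_of_right x (val_one.trans (mul_one c).symm), mul_one]

theorem val_posPow_of_left {z : LocalDivisor c} {x : M} (h : z.val = x * c) (n : ℕ) :
    (posPow z n).val = posPow x n * c := by
  induction n with
  | zero => exact h
  | succ n ih => rw [posPow, val_mul_of_left z ih, h, ← mul_assoc, posPow]

theorem val_posPow_of_right {z : LocalDivisor c} {y : M} (h : z.val = c * y) (n : ℕ) :
    (posPow z n).val = c * posPow y n := by
  induction n with
  | zero => exact h
  | succ n ih => rw [posPow, val_mul_of_right _ h, ih, mul_assoc, posPow]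

/-- The element `c y c` of the local divisor at `c`. -/
def sandwich (c y : M) : LocalDivisor c :=
  ⟨c * y * c, ⟨_, rfl⟩, ⟨y * c, mul_assoc c y c⟩⟩

theorem val_sandwich_mul (y : M) (x : LocalDivisor c) :
    (sandwich c y * x).val = c * y * x.val :=
  val_mul_of_left x rfl

instance [Finite M] : Finite (LocalDivisor c) :=
  Finite.of_injective val val_injective

theorem card_lt [Finite M] (hc : ¬ IsUnit c) : Nat.card (LocalDivisor c) < Nat.card M := by
  have := Fintype.ofFinite M
  have := Fintype.ofFinite (LocalDivisor c)
  rw [Nat.card_eq_fintype_card, Nat.card_eq_fintype_card]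
  refine Fintype.card_lt_of_injective_of_notMem val val_injective (b := 1) ?_
  rintro ⟨x, hx⟩
  obtain ⟨u, hu⟩ := x.left
  obtain ⟨v, hv⟩ := x.right
  rw [hx] at hu hv
  exact hc (isUnit_iff_exists_and_exists.2 ⟨⟨v, hv.symm⟩, ⟨u, hu.symm⟩⟩)

/-- Replacing `x` and `y` by powers with an exponent `≡ 1` modulo a `π'`-period of `z = x c = c y`
does not change `z`, and such powers can be chosen `π'`-periodic. -/
theorem exists_isPiPeriodic_left_right {π : Set Nat.Primes} [Finite M] {z : LocalDivisor c}
    (hz : IsPiPeriodic πᶜ z) : ∃ x y : M, z.val = x * c ∧ z.val = c * y ∧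
      IsPiPeriodic πᶜ x ∧ IsPiPeriodic πᶜ y := by
  obtain ⟨m, hm, hmπ, h⟩ := hz
  obtain ⟨x, hx⟩ := z.left
  obtain ⟨y, hy⟩ := z.right
  obtain ⟨j, hj⟩ := exists_isPiPeriodic_posPow_mul (x, y) hm hmπ
  have hzj : posPow z (j * m) = z := (periodic_posPow h).nat_mul_eq j
  refine ⟨posPow x (j * m), posPow y (j * m), ?_, ?_, ?_, ?_⟩
  · rw [← val_posPow_of_left hx, hzj]
  · rw [← val_posPow_of_right hy, hzj]
  · exact map_posPow (MulHom.fst M M) (x, y) _ ▸ hj.map (MulHom.fst M M)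
  · exact map_posPow (MulHom.snd M M) (x, y) _ ▸ hj.map (MulHom.snd M M)

end Monoid

section Order

variable {M : Type*} [Monoid M] [PartialOrder M] {c : M}

instance : PartialOrder (LocalDivisor c) :=
  PartialOrder.lift val val_injective

theorem le_iff {x y : LocalDivisor c} : x ≤ y ↔ x.val ≤ y.val := Iff.rfl

instance [MulLeftMono M] : MulLeftMono (LocalDivisor c) where
  elim x y z h := by
    obtain ⟨u, hu⟩ := x.left
    change x * y ≤ x * z
    rw [le_iff, val_mul_of_left _ hu, val_mul_of_left _ hu]
    exact mul_le_mul_right (le_iff.1 h) u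

instance [MulRightMono M] : MulRightMono (LocalDivisor c) where
  elim x y z h := by
    obtain ⟨v, hv⟩ := x.right
    change y * x ≤ z * x
    rw [le_iff, val_mul_of_right _ hv, val_mul_of_right _ hv]
    exact mul_le_mul_left (le_iff.1 h) v

theorem piComplete {π : Set Nat.Primes} [Finite M] (hM : PiComplete π M) (c : M) :
    PiComplete π (LocalDivisor c) := by
  intro z hz
  obtain ⟨x, y, hx, hy, hxπ, hyπ⟩ := exists_isPiPeriodic_left_right hz
  obtain ⟨X, hX⟩ := hM x hxπ
  obtain ⟨Y, hY⟩ := hM y hyπ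
  have hXY : X * c = c * Y := by
    have hXc := hX 1 c
    have hcY := hY c 1
    simp only [one_mul, mul_one, ← val_posPow_of_left hx, ← val_posPow_of_right hy] at hXc hcY
    exact hXc.unique hcY
  let W : LocalDivisor c := ⟨X * c, ⟨X, rfl⟩, Y, hXY⟩
  refine ⟨W, fun a b => ?_⟩
  obtain ⟨u, ha⟩ := a.left
  obtain ⟨v, hb⟩ := b.right
  have hW : (a * W * b).val = u * X * (c * v) := by
    rw [val_mul_mul W ha hb, mul_assoc u X, ← mul_assoc X, mul_assoc u]
  have hpow (n : ℕ) : (a * posPow z n * b).val = u * posPow x n * (c * v) := by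
    rw [val_mul_mul _ ha hb, val_posPow_of_left hx]
    simp only [mul_assoc]
  refine IsLUB.of_image (f := val) le_iff ?_
  rw [← Set.range_comp, hW]
  simpa only [Function.comp_def, hpow] using hX u (c * v)

end Order

end LocalDivisor

/-! ### Rees extensions -/

/-- The disjoint union of a monoid `B` and the Rees matrix semigroup `B × D × B` over the monoid `D`
with sandwich matrix `(y, x) ↦ f (y * x)`, on whose outer coordinates `B` acts by multiplication. -/
inductive ReesExtension {B : Type*} {D : Type*} (f : B → D)
  | low (b : B) : ReesExtension f
  | high (x : B) (d : D) (y : B) : ReesExtension f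

namespace ReesExtension

variable {B D : Type*} {f : B → D}

instance [Finite B] [Finite D] : Finite (ReesExtension f) :=
  Finite.of_surjective (α := B ⊕ B × D × B)
    (Sum.elim low fun t => high t.1 t.2.1 t.2.2) <| by
      rintro (b | ⟨x, d, y⟩)
      · exact ⟨.inl b, rfl⟩
      · exact ⟨.inr (x, d, y), rfl⟩

variable [Monoid B] [Monoid D]

instance : Mul (ReesExtension f) where
  mul
    | low b, low b' => low (b * b')
    | low b, high x d y => high (b * x) d y
    | high x d y, low b => high x d (y * b)
    | high x d y, high x' d' y' => high x (d * f (y * x') * d') y'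

theorem low_mul_low (b b' : B) : (low b * low b' : ReesExtension f) = low (b * b') := rfl

theorem low_mul_high (b x y : B) (d : D) :
    (low b * high x d y : ReesExtension f) = high (b * x) d y := rfl

theorem high_mul_low (b x y : B) (d : D) :
    (high x d y * low b : ReesExtension f) = high x d (y * b) := rfl

theorem high_mul_high (x y x' y' : B) (d d' : D) :
    (high x d y * high x' d' y' : ReesExtension f) = high x (d * f (y * x') * d') y' := rfl

instance : Monoid (ReesExtension f) where
  one := low 1
  mul_assoc a b c := by
    cases a <;> cases b <;> cases c <;>
      simp only [low_mul_low, low_mul_high, high_mul_low, high_mul_high, mul_assoc]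
  one_mul a := by
    cases a
    · exact congrArg low (one_mul _)
    · exact congrArg (high · _ _) (one_mul _)
  mul_one a := by
    cases a
    · exact congrArg low (mul_one _)
    · exact congrArg (high _ _) (mul_one _)

theorem one_def : (1 : ReesExtension f) = low 1 := rfl

theorem posPow_low (b : B) (n : ℕ) : posPow (low b : ReesExtension f) n = low (posPow b n) := by
  induction n with
  | zero => rfl
  | succ n ih => rw [posPow, ih, low_mul_low, posPow]

theorem posPow_high (x y : B) (d : D) (n : ℕ) :
    posPow (high x d y : ReesExtension f) n = high x (d * (f (y * x) * d) ^ n) y := by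
  induction n with
  | zero => rw [pow_zero, mul_one, posPow]
  | succ n ih => rw [posPow, ih, high_mul_high, pow_succ, mul_assoc, mul_assoc]

theorem piAperiodic {π : Set Nat.Primes} (hB : PiAperiodic π B) (hD : PiAperiodic π D) :
    PiAperiodic π (ReesExtension f) := by
  rintro (b | ⟨x, d, y⟩) ⟨m, hm, hmπ, h⟩
  · rw [posPow_low] at h
    exact congrArg low (hB b ⟨m, hm, hmπ, low.inj h⟩)
  · rw [posPow_high] at h
    have hd : d * (f (y * x) * d) ^ m = d := (high.inj h).2.1
    have hid : IsIdempotentElem (f (y * x) * d) :=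
      hD _ ⟨m, hm, hmπ, by rw [posPow_eq_pow, pow_succ', mul_assoc, hd]⟩
    rw [hid.pow_eq hm] at hd
    rw [IsIdempotentElem, high_mul_high, mul_assoc, hd]

end ReesExtension

/-! ### Groups -/

section Groups

variable {π : Set Nat.Primes} {G : Type*} [Group G]

/-- The `π`-residual `O^π(G)` of a finite group `G`, generated by the elements of `π'`-order: it is
the smallest normal subgroup whose quotient is a `π`-group. -/
def piResidual (π : Set Nat.Primes) (G : Type*) [Group G] : Subgroup G :=
  Subgroup.normalClosure {g | IsPiPeriodic πᶜ g}

instance normal_piResidual : (piResidual π G).Normal :=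
  Subgroup.normalClosure_normal

theorem piResidual_eq_closure : piResidual π G = Subgroup.closure {g | IsPiPeriodic πᶜ g} := by
  refine le_antisymm (Subgroup.closure_mono fun g hg => ?_) Subgroup.closure_le_normalClosure
  obtain ⟨h, hh, hhg⟩ := Group.mem_conjugatesOfSet_iff.1 hg
  obtain ⟨k, rfl⟩ := isConj_iff.1 hhg
  exact IsPiPeriodic.map (MulAut.conj k) hh

theorem piAperiodic_quotient_piResidual [Finite G] : PiAperiodic π (G ⧸ piResidual π G) := by
  intro z hz
  obtain ⟨m, -, hmπ, hzm⟩ := isPiPeriodic_iff_pow_eq_one.1 hz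
  obtain ⟨g, rfl⟩ := QuotientGroup.mk_surjective z
  obtain ⟨a, r, har, ha, hr⟩ := exists_eq_isPiNumber_mul π (orderOf_pos g).ne'
  have hga : g ^ a ∈ piResidual π G := Subgroup.subset_normalClosure <|
    isPiPeriodic_iff_pow_eq_one.2 ⟨r, right_ne_zero_of_mul (har ▸ (orderOf_pos g).ne'), hr, by
      rw [← pow_mul, ← har, pow_orderOf_eq_one]⟩
  have hza : (g : G ⧸ piResidual π G) ^ a = 1 := (QuotientGroup.eq_one_iff _).2 hga
  have hz1 : (g : G ⧸ piResidual π G) = 1 := by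
    have := pow_gcd_eq_one.2 ⟨hza, hzm⟩
    rwa [(ha.coprime hmπ).gcd_eq_one, pow_one] at this
  rw [hz1]
  exact IsIdempotentElem.one

end Groups

section Units

variable {π : Set Nat.Primes} {M : Type*} [Monoid M] [PartialOrder M]

theorem PiComplete.exists_one_le_le (hM : PiComplete π M) {g : Mˣ} (hg : IsPiPeriodic πᶜ g) :
    ∃ Y : M, 1 ≤ Y ∧ g ≤ Y := by
  obtain ⟨Y, hY⟩ := hM g (hg.map (Units.coeHom M))
  obtain ⟨m, hm, -, hgm⟩ := isPiPeriodic_iff_pow_eq_one.1 hg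
  obtain ⟨k, rfl⟩ := Nat.exists_eq_succ_of_ne_zero hm
  have hle (n : ℕ) : posPow (g : M) n ≤ Y := by
    simpa only [one_mul, mul_one] using (hY 1 1).1 ⟨n, rfl⟩
  refine ⟨Y, ?_, hle 0⟩
  have := hle k
  rwa [posPow_eq_pow, ← Units.val_pow_eq_pow_val, hgm] at this

variable [MulLeftMono M] [MulRightMono M]

theorem PiComplete.exists_one_le_le_of_mem_piResidual [Finite Mˣ] (hM : PiComplete π M) {g : Mˣ}
    (hg : g ∈ piResidual π Mˣ) : ∃ Y : M, 1 ≤ Y ∧ g ≤ Y := by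
  rw [piResidual_eq_closure, ← Subgroup.mem_toSubmonoid,
    Subgroup.closure_toSubmonoid_of_finite] at hg
  induction hg using Submonoid.closure_induction with
  | mem g hg => exact hM.exists_one_le_le hg
  | one => exact ⟨1, le_rfl, le_rfl⟩
  | mul g h _ _ hg hh =>
    obtain ⟨Y, hY1, hgY⟩ := hg
    obtain ⟨Z, hZ1, hhZ⟩ := hh
    exact ⟨Y * Z, one_le_mul hY1 hZ1, mul_le_mul' hgY hhZ⟩

theorem PiComplete.bddAbove_piResidual [Finite Mˣ] (hM : PiComplete π M) :
    BddAbove (Units.val '' (piResidual π Mˣ : Set Mˣ)) := by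
  have : Nonempty {Y : M // 1 ≤ Y} := ⟨1, le_rfl⟩
  have : IsDirectedOrder {Y : M // 1 ≤ Y} := ⟨fun Y Z => ⟨⟨Y * Z, one_le_mul Y.2 Z.2⟩,
    le_mul_of_one_le_right' Z.2, le_mul_of_one_le_left' Y.2⟩⟩
  choose Y hY1 hY using fun g : piResidual π Mˣ => hM.exists_one_le_le_of_mem_piResidual g.2
  obtain ⟨B, hB⟩ := Finite.exists_le fun g => (⟨Y g, hY1 g⟩ : {Y : M // 1 ≤ Y})
  refine ⟨B, ?_⟩
  rintro _ ⟨g, hg, rfl⟩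
  exact (hY ⟨g, hg⟩).trans (hB ⟨g, hg⟩)

end Units

/-! ### Monoid homomorphisms with bounded fibres -/

/-- A homomorphism `μ` to an ordered monoid has bounded fibres over a finite `π`-aperiodic monoid:
for some homomorphism `ψ` to such a monoid, `μ` is bounded above on each fibre of `ψ`. -/
def HasBoundedFibers (π : Set Nat.Primes) {W : Type*} {M : Type u} [Monoid W] [Monoid M]
    [PartialOrder M] (μ : W →* M) : Prop :=
  ∃ (N : Type u) (_ : Monoid N) (_ : Finite N) (ψ : W →* N),
    PiAperiodic π N ∧ ∀ n, BddAbove (μ '' (ψ ⁻¹' {n}))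

section Units

variable {π : Set Nat.Primes} {M : Type u} [Monoid M] [PartialOrder M] [MulLeftMono M]
  [MulRightMono M]

theorem PiComplete.hasBoundedFibers_coeHom_comp [Finite Mˣ] (hM : PiComplete π M) {W : Type*}
    [Monoid W] (ν : W →* Mˣ) : HasBoundedFibers π ((Units.coeHom M).comp ν) := by
  obtain ⟨Y, hY⟩ := hM.bddAbove_piResidual
  refine ⟨Mˣ ⧸ piResidual π Mˣ, inferInstance, inferInstance, (QuotientGroup.mk' _).comp ν,
    piAperiodic_quotient_piResidual, fun n => ?_⟩
  obtain ⟨g, rfl⟩ := QuotientGroup.mk_surjective n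
  refine ⟨g * Y, ?_⟩
  rintro _ ⟨w, hw, rfl⟩
  have hgw : g⁻¹ * ν w ∈ piResidual π Mˣ := QuotientGroup.eq.1 (Eq.symm hw)
  calc (ν w : M) = g * (g⁻¹ * ν w : Mˣ) := by rw [← Units.val_mul, mul_inv_cancel_left]
    _ ≤ g * Y := mul_le_mul_right (hY ⟨_, hgw, rfl⟩) _

theorem PiComplete.hasBoundedFibers_lift_of_isUnit [Finite Mˣ] (hM : PiComplete π M) {A : Type*}
    {α : A → M} (hα : ∀ a, IsUnit (α a)) : HasBoundedFibers π (FreeMonoid.lift α) := by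
  choose β hβ using hα
  convert hM.hasBoundedFibers_coeHom_comp (FreeMonoid.lift β)
  rw [FreeMonoid.comp_lift]
  exact congrArg _ (funext fun a => (hβ a).symm)

end Units

/-- The value `c Y(b₁) c ⋯ c Y(bₙ) c` of a word `b₁ ⋯ bₙ`, as an element of the local divisor. -/
noncomputable def sandwichHom {M B : Type*} [Monoid M] (c : M) (Y : B → M) :
    FreeMonoid B →* LocalDivisor c :=
  FreeMonoid.lift fun b => LocalDivisor.sandwich c (Y b)

theorem val_sandwichHom_of_mul {M B : Type*} [Monoid M] {c : M} {Y : B → M} (b : B)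
    (v : FreeMonoid B) :
    (sandwichHom c Y (FreeMonoid.of b * v)).val = c * Y b * (sandwichHom c Y v).val := by
  rw [map_mul, sandwichHom, FreeMonoid.lift_eval_of, LocalDivisor.val_sandwich_mul]

section Cuts

variable {M W B D : Type*} [Monoid M] [PartialOrder M] [Monoid W] [Monoid B] [Monoid D]
  {c : M} {μ : W →* M} {ψ : W →* B} {F : FreeMonoid B →* D} {Y : B → M}

/-- A product of values of `μ` and of copies of `c` cut at these copies is either a single value
`μ u`, or is bounded by `μ u (c Y(b₁) c ⋯ c Y(bₙ) c) μ u'`, where `b₁, …, bₙ` are the images under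
`ψ` of the inner blocks. This records the images of the blocks in a Rees extension. -/
inductive IsCut (c : M) (μ : W →* M) (ψ : W →* B) (F : FreeMonoid B →* D) (Y : B → M) :
    M → ReesExtension (fun b => F (FreeMonoid.of b)) → Prop
  | low (u : W) : IsCut c μ ψ F Y (μ u) (.low (ψ u))
  | high (u : W) (v : FreeMonoid B) (u' : W) {x : M}
      (hx : x ≤ μ u * (sandwichHom c Y v).val * μ u') :
      IsCut c μ ψ F Y x (.high (ψ u) (F v) (ψ u'))

variable {x : M} {r : ReesExtension fun b => F (FreeMonoid.of b)}

theorem isCut_one : IsCut c μ ψ F Y 1 1 := by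
  simpa only [map_one, ReesExtension.one_def] using
    IsCut.low (c := c) (μ := μ) (ψ := ψ) (F := F) (Y := Y) 1

variable [MulLeftMono M]

theorem IsCut.low_mul (h : IsCut c μ ψ F Y x r) (w : W) :
    IsCut c μ ψ F Y (μ w * x) (.low (ψ w) * r) := by
  cases h with
  | low u =>
    rw [ReesExtension.low_mul_low, ← map_mul, ← map_mul]
    exact .low (w * u)
  | high u v u' hx =>
    rw [ReesExtension.low_mul_high, ← map_mul]
    refine .high (w * u) v u' ?_
    simpa only [map_mul, mul_assoc] using mul_le_mul_right hx (μ w)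

variable [MulRightMono M]

theorem IsCut.high_one_mul (hY : ∀ u, μ u ≤ Y (ψ u)) (h : IsCut c μ ψ F Y x r) :
    IsCut c μ ψ F Y (c * x) (.high 1 1 1 * r) := by
  cases h with
  | low u =>
    rw [ReesExtension.high_mul_low, one_mul, ← map_one ψ, ← map_one F]
    refine .high 1 1 u ?_
    rw [map_one, map_one, one_mul, LocalDivisor.val_one]
  | high u v u' hx =>
    rw [ReesExtension.high_mul_high, one_mul, one_mul, ← map_mul, ← map_one ψ]
    refine .high 1 (FreeMonoid.of (ψ u) * v) u' ?_
    rw [map_one, one_mul, val_sandwichHom_of_mul]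
    calc c * x ≤ c * (μ u * (sandwichHom c Y v).val * μ u') := mul_le_mul_right hx c
      _ = c * μ u * (sandwichHom c Y v).val * μ u' := by simp only [mul_assoc]
      _ ≤ c * Y (ψ u) * (sandwichHom c Y v).val * μ u' := by gcongr; exact hY u

theorem bddAbove_setOf_isCut (hY : ∀ u, μ u ≤ Y (ψ u))
    (hF : ∀ d, BddAbove (sandwichHom c Y '' (F ⁻¹' {d})))
    (r : ReesExtension fun b => F (FreeMonoid.of b)) : BddAbove {x | IsCut c μ ψ F Y x r} := by
  cases r with
  | low b =>
    refine ⟨Y b, ?_⟩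
    rintro _ ⟨u⟩
    exact hY u
  | high b d b' =>
    obtain ⟨Z, hZ⟩ := hF d
    refine ⟨Y b * Z.val * Y b', ?_⟩
    intro x hx
    cases hx with | high u v u' hx => ?_
    have hvZ : (sandwichHom c Y v).val ≤ Z.val := hZ ⟨v, rfl, rfl⟩
    exact hx.trans (mul_le_mul' (mul_le_mul' (hY u) hvZ) (hY u'))

end Cuts

section Recursion

variable {π : Set Nat.Primes} {M : Type u} [Monoid M] [PartialOrder M] [MulLeftMono M]
  [MulRightMono M]

theorem hasBoundedFibers_lift_of_localDivisor {A : Type*} (α : A → M) (a₀ : A)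
    (hB : HasBoundedFibers π (FreeMonoid.lift fun a : {a // a ≠ a₀} => α a))
    (hD : ∀ (B : Type u) [Finite B] (β : B → LocalDivisor (α a₀)),
      HasBoundedFibers π (FreeMonoid.lift β)) :
    HasBoundedFibers π (FreeMonoid.lift α) := by
  classical
  obtain ⟨B, _, _, ψ, hBπ, hψ⟩ := hB
  choose Y hY using hψ
  replace hY u : FreeMonoid.lift (fun a : {a // a ≠ a₀} => α a) u ≤ Y (ψ u) :=
    hY _ ⟨u, rfl, rfl⟩
  obtain ⟨D, _, _, F, hDπ, hF⟩ := hD B fun b => LocalDivisor.sandwich (α a₀) (Y b)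
  let χ : FreeMonoid A →* ReesExtension fun b => F (FreeMonoid.of b) := FreeMonoid.lift fun a =>
    if h : a = a₀ then .high 1 1 1 else .low (ψ (FreeMonoid.of ⟨a, h⟩))
  have hχ (w : FreeMonoid A) : IsCut (α a₀)
      (FreeMonoid.lift fun a : {a // a ≠ a₀} => α a) ψ F Y (FreeMonoid.lift α w) (χ w) := by
    induction w using FreeMonoid.inductionOn' with
    | one => simpa only [map_one] using isCut_one
    | of_mul a w ih =>
      rw [map_mul, map_mul, FreeMonoid.lift_eval_of, FreeMonoid.lift_eval_of]
      by_cases h : a = a₀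
      · rw [dif_pos h, h]
        exact ih.high_one_mul hY
      · rw [dif_neg h]
        exact ih.low_mul (FreeMonoid.of ⟨a, h⟩)
  refine ⟨_, inferInstance, inferInstance, χ, ReesExtension.piAperiodic hBπ hDπ,
    fun r => ?_⟩
  refine (bddAbove_setOf_isCut hY hF r).mono ?_
  rintro _ ⟨w, rfl, rfl⟩
  exact hχ w

end Recursion

/-- Induction on `(|M|, |A|)`. A non-unit letter `α a` is removed from the alphabet, and the words
between its occurrences become the letters of a new alphabet over its local divisor. -/
theorem PiComplete.hasBoundedFibers_lift {π : Set Nat.Primes} {M : Type u} [Monoid M]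
    [PartialOrder M] [MulLeftMono M] [MulRightMono M] [Finite M] (hM : PiComplete π M)
    {A : Type u} [Finite A] (α : A → M) : HasBoundedFibers π (FreeMonoid.lift α) := by
  by_cases hα : ∀ a, IsUnit (α a)
  · exact hM.hasBoundedFibers_lift_of_isUnit hα
  obtain ⟨a, ha⟩ := not_forall.1 hα
  exact hasBoundedFibers_lift_of_localDivisor α a (hM.hasBoundedFibers_lift _)
    fun B _ β => (LocalDivisor.piComplete hM (α a)).hasBoundedFibers_lift β
termination_by (Nat.card M, Nat.card A)
decreasing_by
  · exact Prod.Lex.right _ (Finite.card_subtype_lt (not_not.2 rfl))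
  · exact Prod.Lex.left _ _ (LocalDivisor.card_lt ha)

/-! ### The semigroup `CP` -/

section CP

variable {π : Set Nat.Primes} {T : Type u} [Semigroup T] [Finite T] {Z : Set T}

theorem generatesPiGroup_iff : GeneratesPiGroup π Z ↔ IsPiPeriodic π Z :=
  isPiSubgroup_closure_singleton_iff

theorem IsPiPeriodic.omegaPlusStar_eq_iUnion (hZ : IsPiPeriodic π Z) :
    omegaPlusStar Z = ⋃ n, posPow Z n := by
  rw [omegaPlusStar, Set.mul_iUnion]
  exact Set.iUnion_congr hZ.omegaPow_mul_posPow

theorem singleton_mem_CP (t : T) : {t} ∈ CP π T :=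
  Subsemigroup.mem_sInf.2 fun _ hU => hU.1 t

theorem iUnion_posPow_mem_CP (hZ : Z ∈ CP π T) (hZπ : IsPiPeriodic πᶜ Z) :
    ⋃ n, posPow Z n ∈ CP π T :=
  Subsemigroup.mem_sInf.2 fun U hU => hZπ.omegaPlusStar_eq_iUnion ▸
    hU.2 Z (Subsemigroup.mem_sInf.1 hZ U hU) (generatesPiGroup_iff.2 hZπ)

theorem CP_le {U : Subsemigroup (Set T)} (hU : ∀ t : T, {t} ∈ U)
    (hU' : ∀ Z ∈ U, IsPiPeriodic πᶜ Z → ⋃ n, posPow Z n ∈ U) : CP π T ≤ U :=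
  sInf_le ⟨hU, fun Z hZ h => by
    have hZπ := generatesPiGroup_iff.1 h
    exact hZπ.omegaPlusStar_eq_iUnion ▸ hU' Z hZ hZπ⟩

end CP

section CPWithOne

variable {π : Set Nat.Primes}

theorem piComplete_submonoid_set {R : Type*} [Monoid R] (P : Submonoid (Set R))
    (hP : ∀ Z ∈ P, IsPiPeriodic πᶜ Z → ⋃ n, posPow Z n ∈ P) : PiComplete π P := by
  intro Z hZ
  refine ⟨⟨⋃ n, posPow (Z : Set R) n, hP Z Z.2 (hZ.map P.subtype)⟩, fun a b => ?_⟩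
  have hpow (n : ℕ) : ((posPow Z n : P) : Set R) = posPow (Z : Set R) n :=
    map_posPow P.subtype Z n
  refine IsLUB.of_image (f := ((↑) : P → Set R)) Iff.rfl ?_
  rw [← Set.range_comp, Submonoid.coe_mul, Submonoid.coe_mul, Set.mul_iUnion, Set.iUnion_mul]
  simp only [Function.comp_def, Submonoid.coe_mul, hpow]
  exact isLUB_iSup

/-- The embedding of the power semigroup of `T` into that of `T` with an identity adjoined. -/
def imageWithOne (T : Type*) [Semigroup T] : Set T →ₙ* Set (WithOne T) where
  toFun X := WithOne.coeMulHom '' X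
  map_mul' _ _ := Set.image_mul WithOne.coeMulHom

theorem imageWithOne_injective {T : Type*} [Semigroup T] : Function.Injective (imageWithOne T) :=
  Set.image_injective.2 WithOne.coe_injective

variable {T : Type u} [Semigroup T] [Finite T]

/-- `CP π T` with an identity adjoined, realized inside the power monoid of `WithOne T`. -/
def CPWithOne (π : Set Nat.Primes) (T : Type u) [Semigroup T] [Finite T] :
    Submonoid (Set (WithOne T)) where
  carrier := insert 1 (imageWithOne T '' CP π T)
  one_mem' := .inl rfl
  mul_mem' := by
    rintro _ _ (rfl | ⟨Y, hY, rfl⟩) (rfl | ⟨Z, hZ, rfl⟩)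
    · exact .inl (one_mul 1)
    · exact .inr ⟨Z, hZ, (one_mul _).symm⟩
    · exact .inr ⟨Y, hY, (mul_one _).symm⟩
    · exact .inr ⟨Y * Z, mul_mem hY hZ, map_mul _ Y Z⟩

instance : MulLeftMono (CPWithOne π T) where
  elim _ _ _ h := Set.mul_subset_mul_left h

instance : MulRightMono (CPWithOne π T) where
  elim _ _ _ h := Set.mul_subset_mul_right h

theorem piComplete_CPWithOne : PiComplete π (CPWithOne π T) := by
  refine piComplete_submonoid_set _ ?_
  rintro _ (rfl | ⟨Z, hZ, rfl⟩) h
  · simp only [posPow_eq_pow, one_pow, Set.iUnion_const]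
    exact one_mem _
  · obtain ⟨m, hm, hmπ, hZm⟩ := h
    have hZπ : IsPiPeriodic πᶜ Z :=
      ⟨m, hm, hmπ, imageWithOne_injective (by rw [map_posPow, hZm])⟩
    simp only [← map_posPow]
    exact .inr ⟨_, iUnion_posPow_mem_CP hZ hZπ, Set.image_iUnion⟩

/-- The singleton `{t}` as an element of `CPWithOne π T`. -/
def CPWithOne.singleton (π : Set Nat.Primes) (t : T) : CPWithOne π T :=
  ⟨imageWithOne T {t}, .inr ⟨_, singleton_mem_CP t, rfl⟩⟩

theorem CPWithOne.coe_lift_singleton (w : FreeMonoid T) :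
    (FreeMonoid.lift (CPWithOne.singleton π) w : Set (WithOne T)) =
      {FreeMonoid.lift ((↑) : T → WithOne T) w} := by
  have : (CPWithOne π T).subtype.comp (FreeMonoid.lift (CPWithOne.singleton π)) =
      Set.singletonMonoidHom.comp (FreeMonoid.lift ((↑) : T → WithOne T)) :=
    FreeMonoid.hom_eq fun t => Set.image_singleton
  exact DFunLike.congr_fun this w

end CPWithOne

/-! ### Pointlike sets -/

section Pointlikes

variable {π : Set Nat.Primes} {T : Type u} [Semigroup T] {X : Set T}

theorem pointlikes_gBar_subset :
    pointlikes.{u, v} (GBar.{v} π) T ⊆ pointlikes.{u, w} (GBar.{w} π) T := by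
  intro X hX S _ hS φ
  obtain ⟨_, hS⟩ := gBar_iff.1 hS
  let f : Shrink.{v} S ≃* S := Shrink.mulEquiv
  obtain ⟨s, hs⟩ := hX (Shrink.{v} S)
    (gBar_iff.2 ⟨.of_equiv S f.symm.toEquiv, hS.of_injective f f.injective⟩)
    { rel := fun t s => φ.rel t (f s)
      total := fun t => (φ.total t).imp' f.symm fun s h => by rwa [f.apply_symm_apply]
      mul := fun h h' => by rw [map_mul]; exact φ.mul h h' }
  exact ⟨f s, hs⟩

theorem nonempty_of_mem_pointlikes (hX : X ∈ pointlikes.{u, v} (GBar.{v} π) T) : Nonempty T := by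
  by_contra hT
  rw [not_nonempty_iff] at hT
  obtain ⟨s, -⟩ := pointlikes_gBar_subset hX T (gBar_iff.2 ⟨inferInstance, isEmptyElim⟩)
    ⟨fun _ _ => True, isEmptyElim, fun _ _ => trivial⟩
  exact isEmptyElim s

/-- The relational morphism from `T` to `N` which relates the values of a word over `T` in `T` and
in `N`. The values in `T` are computed in `WithOne T`, to account for the empty word. -/
def RelMorphism.ofFreeMonoid {T : Type u} {N : Type v} [Semigroup T] [Monoid N]
    (ψ : FreeMonoid T →* N) : RelMorphism T N where
  rel t n := ∃ w, FreeMonoid.lift ((↑) : T → WithOne T) w = t ∧ ψ w = n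
  total t := ⟨ψ (.of t), .of t, FreeMonoid.lift_eval_of _ t, rfl⟩
  mul := by
    rintro t t' _ _ ⟨w, hw, rfl⟩ ⟨w', hw', rfl⟩
    exact ⟨w * w', by rw [map_mul, hw, hw', WithOne.coe_mul], map_mul ψ w w'⟩

theorem exists_mem_CP_of_mem_pointlikes [Finite T]
    (hX : X ∈ pointlikes.{u, v} (GBar.{v} π) T) : ∃ Y ∈ CP π T, X ⊆ Y := by
  have : Finite (WithOne T) := inferInstanceAs (Finite (Option T))
  obtain ⟨N, _, _, ψ, hN, hψ⟩ :=
    piComplete_CPWithOne.hasBoundedFibers_lift (CPWithOne.singleton (T := T) π)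
  obtain ⟨n, hn⟩ := pointlikes_gBar_subset hX N (gBar_iff.2 ⟨inferInstance, hN⟩) (.ofFreeMonoid ψ)
  obtain ⟨Y, hY⟩ := hψ n
  have hXY : ∀ x ∈ X, (x : WithOne T) ∈ (Y : Set (WithOne T)) := by
    intro x hx
    obtain ⟨w, hw, hwn⟩ := hn hx
    have hwY : (FreeMonoid.lift (CPWithOne.singleton π) w : Set (WithOne T)) ⊆ Y :=
      hY ⟨w, hwn, rfl⟩
    rw [CPWithOne.coe_lift_singleton, hw] at hwY
    exact hwY rfl
  obtain ⟨_, rfl | ⟨Z, hZ, rfl⟩⟩ := Y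
  · obtain ⟨t⟩ := nonempty_of_mem_pointlikes hX
    exact ⟨{t}, singleton_mem_CP t, fun x hx => absurd (hXY x hx) WithOne.coe_ne_one⟩
  · refine ⟨Z, hZ, fun x hx => ?_⟩
    obtain ⟨z, hz, hzx⟩ := hXY x hx
    rwa [← WithOne.coe_injective hzx]

section Covered

variable {S : Type v} [Semigroup S] (φ : RelMorphism T S) {Z : Set T}

/-- The semigroup of the subsets of `T` contained in some `s φ⁻¹`. -/
def RelMorphism.covered : Subsemigroup (Set T) where
  carrier := {Z | ∃ s, Z ⊆ φ.inv s}
  mul_mem' := by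
    rintro Z Z' ⟨s, hs⟩ ⟨s', hs'⟩
    exact ⟨s * s', Set.mul_subset_iff.2 fun z hz z' hz' => φ.mul (hs hz) (hs' hz')⟩

theorem RelMorphism.posPow_subset_inv {s : S} (h : Z ⊆ φ.inv s) (n : ℕ) :
    posPow Z n ⊆ φ.inv (posPow s n) := by
  induction n with
  | zero => exact h
  | succ n ih => exact Set.mul_subset_iff.2 fun z hz z' hz' => φ.mul (ih hz) (h hz')

theorem PiAperiodic.iUnion_posPow_mem_covered [Finite S] (hS : PiAperiodic π S)
    (hZ : Z ∈ φ.covered) (hZπ : IsPiPeriodic πᶜ Z) : ⋃ n, posPow Z n ∈ φ.covered := by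
  obtain ⟨s, hs⟩ := hZ
  obtain ⟨m, hm, hmπ, hZm⟩ := hZπ
  obtain ⟨j, hj⟩ := exists_isPiPeriodic_posPow_mul s hm hmπ
  have hZj : Z ⊆ φ.inv (posPow s (j * m)) := by
    have hper : posPow Z (j * m) = Z := (periodic_posPow hZm).nat_mul_eq j
    exact hper ▸ φ.posPow_subset_inv hs (j * m)
  refine ⟨posPow s (j * m), Set.iUnion_subset fun n => ?_⟩
  simpa only [posPow_of_isIdempotentElem (hS _ hj)] using φ.posPow_subset_inv hZj n

end Covered

theorem mem_pointlikes_of_mem_CP [Finite T] (hX : X ∈ CP π T) :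
    X ∈ pointlikes.{u, v} (GBar.{v} π) T := by
  intro S _ hS φ
  obtain ⟨_, hS⟩ := gBar_iff.1 hS
  have hle : CP π T ≤ φ.covered := by
    refine CP_le (fun t => ?_) fun Z => hS.iUnion_posPow_mem_covered φ
    obtain ⟨s, hs⟩ := φ.total t
    exact ⟨s, Set.singleton_subset_iff.2 hs⟩
  exact hle hX

end Pointlikes

end PiPointlike

theorem mainTheorem1 (π : Set Nat.Primes) (T : Type u) [Semigroup T] [Finite T] :
    PiPointlike.pointlikes.{u, v} (PiPointlike.GBar.{v} π) T =
      {X : Set T | ∃ Y ∈ PiPointlike.CP π T, X ⊆ Y} := by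
  ext X
  refine ⟨PiPointlike.exists_mem_CP_of_mem_pointlikes, ?_⟩
  rintro ⟨Y, hY, hXY⟩ S _ hS φ
  obtain ⟨s, hs⟩ := PiPointlike.mem_pointlikes_of_mem_CP hY S hS φ
  exact ⟨s, hXY.trans hs⟩
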